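/- Positions are pairs $(i,j)\in\mathbb Z^2$ (row $i$, increasing downwards; column $j$, increasing to the right). A *pipe dream* is a finite subset $P\subseteq\{(i,j)\in\mathbb Z^2: i+j-1\ge 1\}$; its transpose is $P^t=\{(j,i):(i,j)\in P\}$, and $\sigma^k(P)=\{(i+k,j-k):(i,j)\in P\}$ for $k\in\mathbb Z$. A *super pipe dream* is a pair $\mathbf W=(W_x,W_y)$ of pipe dreams, not necessarily disjoint, viewed as black checkers at $W_x$ and red checkers at $W_y$; its *adjoint* is $\mathbf W^\dagger=(W_y^t,W_x^t)$. *Flow.* For $j\in\mathbb Z$ and a super pipe dream $\mathbf P$ with no red checkers in column $j+1$, $Y_j^+\mathbf P$ is obtained by repeating the following until column $j$ has no red checkers. Let $(i,j)$ be the lowest red checker of column $j$. If there is a checker at $(i,j+1)$, swap the checkers at $(i,j)$ with those at $(i,j+1)$. Otherwise let $(i',j)$ be the first position above $(i,j)$ with no checkers, move the red checker at $(i,j)$ to $(i',j+1)$, and in each row strictly between $i'$ and $i$ swap the checkers in column $j$ with those in column $j+1$. Let $Y^+\mathbf P=Y^+_mY^+_{m+1}\cdots Y^+_M\mathbf P$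 (with $Y^+_M$ applied first), where $m\le M$ are such that all red checkers of $\mathbf P$ are in columns $m,\dots,M$; this does not depend on $m,M$. The map $Y^+$ is a bijection of the set of super pipe dreams; let $Y^-$ be its inverse. *Rectification.* Given $\mathbf W$, choose $m\ge 0$ such that in $\mathbf W'=(Y^+)^m\mathbf W$ every red checker is strictly northeast of every black checker, and put $\mathrm{Rect}(\mathbf W)=(V,U)$ where $V=W'_x$ and $U^t=\sigma^m(W'_y)$. Dually, choose $m\ge 0$ such that in $\mathbf W'=(Y^-)^m\mathbf W$ every red checker is strictly southwest of every black checker, and put $\mathrm{coRect}(\mathbf W)=(V,U)$ where $V=W'_x$ and $U^t=\sigma^{-m}(W'_y)$. Such $m$ exist, and the results do not depend on the choice; for definiteness take the least one. **Proposition 6.3.** Let $\mathbf W$ be a super pipe dream, and let $V,U$ be pipe dreams. (i) If $\mathrm{Rect}(\mathbf W)=(V,U)$, then $\mathrm{Rect}(\mathbf W^\dagger)=(U,V)$. (ii) If $\mathrm{coRect}(\mathbf W)=(V,U)$, then $\mathrm{coRect}(\mathbf W^\dagger)=(U,V)$. -/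

import Mathlib

/-- A placement of finitely many black and red checkers on the board `ℤ × ℤ`
(row index first, rows increasing downwards, columns increasing to the right),
at most one checker of each color in a position. -/
@[ext]
structure Board where
  black : Finset (ℤ × ℤ)
  red : Finset (ℤ × ℤ)

namespace Board

/-- The positions that hold at least one checker. -/
def occ (P : Board) : Finset (ℤ × ℤ) := P.black ∪ P.red

theorem exists_empty_above (P : Board) (i j : ℤ) :
    ∃ d : ℕ, (i - 1 - (d : ℤ), j) ∉ P.occ := by
  by_contra! h
  have hinj : Function.Injective (fun d : ℕ => ((i - 1 - (d : ℤ), j) : ℤ × ℤ)) := by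
    intro a b hab
    simp only [Prod.mk.injEq, and_true] at hab
    omega
  exact Set.infinite_of_injective_forall_mem hinj (s := (P.occ : Set (ℤ × ℤ)))
    (fun d => h d) P.occ.finite_toSet

/-- The row `i' < i` such that `(i', j)` is the first position above `(i, j)` with no checkers. -/
def emptyAbove (P : Board) (i j : ℤ) : ℤ :=
  i - 1 - (Nat.find (P.exists_empty_above i j) : ℤ)

/-- The rows of the red checkers in column `j`. -/
def redRows (P : Board) (j : ℤ) : Finset ℤ :=
  (P.red.filter (fun p => p.2 = j)).image Prod.fst

/-- Exchange the positions `(r, j)` and `(r, j + 1)` for every row `r ∈ R`. -/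
def swapRows (j : ℤ) (R : Finset ℤ) (p : ℤ × ℤ) : ℤ × ℤ :=
  if p.1 ∈ R then (p.1, Equiv.swap j (j + 1) p.2) else p

/-- One ladder modification: let `(i, j)` be the lowest red checker of column `j`
(if there is none, do nothing).

If there is a checker at `(i, j + 1)`, then swap the checkers at `(i, j)` with those
at `(i, j + 1)`.

Otherwise let `(i', j)` be the first position above `(i, j)` with no checkers; move the red
checker at `(i, j)` to `(i', j + 1)`, and in each of the rows strictly between `i'` and `i`
swap the checkers in column `j` with those in column `j + 1`. -/
noncomputable def flowStep (j : ℤ) (P : Board) : Board :=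
  if h : (P.redRows j).Nonempty then
    let i := (P.redRows j).max' h
    if (i, j + 1) ∈ P.occ then
      { black := P.black.image (swapRows j {i})
        red := P.red.image (swapRows j {i}) }
    else
      let i' := P.emptyAbove i j
      { black := P.black.image (swapRows j (Finset.Ioo i' i))
        red := insert (i', j + 1) ((P.red.erase (i, j)).image (swapRows j (Finset.Ioo i' i))) }
  else P

/-- The operator `Y⁺ⱼ`, used on boards without red checkers in column `j + 1`: repeat the ladder
modification until column `j` has no red checkers. Every repetition removes at least one red checker
from column `j`, and `flowStep` does nothing once there is none. -/
noncomputable def flowCol (j : ℤ) (P : Board) : Board :=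
  (flowStep j)^[(P.redRows j).card] P

/-- `Y⁺_{M-n+1} ⋯ Y⁺_{M-1} Y⁺_M P` (column `M` is processed first). -/
noncomputable def flowRange (P : Board) (M : ℤ) : ℕ → Board
  | 0 => P
  | n + 1 => (flowRange P M n).flowCol (M - n)

/-- All red checkers are in columns between `-redBound` and `redBound`. -/
def redBound (P : Board) : ℕ := P.red.sup (fun p => p.2.natAbs)

/-- The operator `Y⁺ = ⋯ Y⁺₋₁ Y⁺₀ Y⁺₁ ⋯`: process all columns that may hold red checkers,
from right to left. -/
noncomputable def flow (P : Board) : Board :=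
  P.flowRange P.redBound (2 * P.redBound + 1)

/-- Half-turn of the board; only used to write down the inverse of `flow`. -/
def rot (P : Board) : Board where
  black := P.black.image (fun p => -p)
  red := P.red.image (fun p => -p)

/-! ### Basic facts about the flow of a column -/

theorem mem_occ {P : Board} {p : ℤ × ℤ} : p ∈ P.occ ↔ p ∈ P.black ∨ p ∈ P.red := by
  simp [occ]

theorem mem_redRows {P : Board} {j i : ℤ} : i ∈ P.redRows j ↔ (i, j) ∈ P.red := by
  simp [redRows]

theorem swapRows_swapRows (j : ℤ) (R : Finset ℤ) (p : ℤ × ℤ) :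
    swapRows j R (swapRows j R p) = p := by
  unfold swapRows
  split_ifs <;> simp_all

theorem mem_image_swapRows {j : ℤ} {R : Finset ℤ} {S : Finset (ℤ × ℤ)} {p : ℤ × ℤ} :
    p ∈ S.image (swapRows j R) ↔ swapRows j R p ∈ S := by
  constructor
  · intro h
    obtain ⟨q, hq, rfl⟩ := Finset.mem_image.1 h
    rwa [swapRows_swapRows]
  · intro h
    exact Finset.mem_image.2 ⟨_, h, swapRows_swapRows j R p⟩

theorem mem_image_neg {S : Finset (ℤ × ℤ)} {p : ℤ × ℤ} :
    p ∈ S.image (fun p => -p) ↔ -p ∈ S := by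
  constructor
  · intro h
    obtain ⟨q, hq, rfl⟩ := Finset.mem_image.1 h
    simpa using hq
  · intro h
    exact Finset.mem_image.2 ⟨_, h, neg_neg p⟩

theorem rot_rot (P : Board) : P.rot.rot = P := by
  ext p
  · exact mem_image_neg.trans (mem_image_neg.trans (by rw [neg_neg]))
  · exact mem_image_neg.trans (mem_image_neg.trans (by rw [neg_neg]))

theorem mem_black_rot {P : Board} {p : ℤ × ℤ} : p ∈ P.rot.black ↔ -p ∈ P.black := mem_image_neg

theorem mem_red_rot {P : Board} {p : ℤ × ℤ} : p ∈ P.rot.red ↔ -p ∈ P.red := mem_image_neg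

theorem mem_occ_rot {P : Board} {p : ℤ × ℤ} : p ∈ P.rot.occ ↔ -p ∈ P.occ := by
  simp [mem_occ, mem_black_rot, mem_red_rot]

theorem emptyAbove_eq {P : Board} {i j e : ℤ} (he : e < i) (hemp : (e, j) ∉ P.occ)
    (hocc : ∀ r, e < r → r < i → (r, j) ∈ P.occ) : P.emptyAbove i j = e := by
  have h : Nat.find (P.exists_empty_above i j) = (i - 1 - e).toNat := by
    rw [Nat.find_eq_iff]
    constructor
    · rwa [show i - 1 - ((i - 1 - e).toNat : ℤ) = e by omega]
    · intro n hn
      rw [not_not]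
      exact hocc _ (by omega) (by omega)
  rw [emptyAbove, h]
  omega

theorem emptyAbove_lt (P : Board) (i j : ℤ) : P.emptyAbove i j < i := by
  unfold emptyAbove
  omega

theorem emptyAbove_notMem (P : Board) (i j : ℤ) : (P.emptyAbove i j, j) ∉ P.occ :=
  Nat.find_spec (P.exists_empty_above i j)

theorem mem_occ_of_emptyAbove_lt {P : Board} {i j r : ℤ} (h : P.emptyAbove i j < r)
    (hr : r < i) : (r, j) ∈ P.occ := by
  have h' := Nat.find_min (P.exists_empty_above i j) (m := (i - 1 - r).toNat)
    (by unfold emptyAbove at h; omega)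
  rw [not_not] at h'
  rwa [show i - 1 - ((i - 1 - r).toNat : ℤ) = r by omega] at h'

/-- `i` is the row of the lowest red checker in column `j`. -/
def IsLowest (P : Board) (j i : ℤ) : Prop :=
  (i, j) ∈ P.red ∧ ∀ r, (r, j) ∈ P.red → r ≤ i

theorem flowStep_of_empty {P : Board} {j : ℤ} (h : ∀ r, (r, j) ∉ P.red) : P.flowStep j = P := by
  rw [flowStep, dif_neg]
  rintro ⟨r, hr⟩
  exact h r (mem_redRows.1 hr)

theorem exists_isLowest {P : Board} {j : ℤ} (h : ∃ r, (r, j) ∈ P.red) : ∃ i, P.IsLowest j i := by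
  obtain ⟨r, hr⟩ := h
  have hne : (P.redRows j).Nonempty := ⟨r, mem_redRows.2 hr⟩
  exact ⟨(P.redRows j).max' hne, mem_redRows.1 (Finset.max'_mem _ _),
    fun r hr => Finset.le_max' _ _ (mem_redRows.2 hr)⟩

theorem IsLowest.max' {P : Board} {j i : ℤ} (h : P.IsLowest j i)
    (hne : (P.redRows j).Nonempty) : (P.redRows j).max' hne = i :=
  le_antisymm (Finset.max'_le _ _ _ fun r hr => h.2 r (mem_redRows.1 hr))
    (Finset.le_max' _ _ (mem_redRows.2 h.1))

theorem flowStep_small {P : Board} {j i : ℤ} (h : P.IsLowest j i) (ho : (i, j + 1) ∈ P.occ) :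
    P.flowStep j = ⟨P.black.image (swapRows j {i}), P.red.image (swapRows j {i})⟩ := by
  have hne : (P.redRows j).Nonempty := ⟨i, mem_redRows.2 h.1⟩
  rw [flowStep, dif_pos hne]
  simp only [h.max' hne]
  rw [if_pos ho]

theorem flowStep_big {P : Board} {j i e : ℤ} (h : P.IsLowest j i) (ho : (i, j + 1) ∉ P.occ)
    (he : P.emptyAbove i j = e) :
    P.flowStep j = ⟨P.black.image (swapRows j (Finset.Ioo e i)),
      insert (e, j + 1) ((P.red.erase (i, j)).image (swapRows j (Finset.Ioo e i)))⟩ := by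
  have hne : (P.redRows j).Nonempty := ⟨i, mem_redRows.2 h.1⟩
  rw [flowStep, dif_pos hne]
  simp only [h.max' hne]
  rw [if_neg ho, he]

/-- During the processing of column `j`, the red checkers in column `j` are
strictly above those in column `j + 1`. -/
def FlowInv (P : Board) (j : ℤ) : Prop :=
  ∀ a b, (a, j) ∈ P.red → (b, j + 1) ∈ P.red → a < b

theorem swapRows_left {j : ℤ} {R : Finset ℤ} {r : ℤ} (h : r ∈ R) :
    swapRows j R (r, j) = (r, j + 1) := by
  simp [swapRows, h]

theorem swapRows_right {j : ℤ} {R : Finset ℤ} {r : ℤ} (h : r ∈ R) :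
    swapRows j R (r, j + 1) = (r, j) := by
  simp [swapRows, h]

theorem swapRows_of_notMem {j : ℤ} {R : Finset ℤ} {r c : ℤ} (h : r ∉ R) :
    swapRows j R (r, c) = (r, c) := by
  simp [swapRows, h]

theorem swapRows_of_ne {j : ℤ} {R : Finset ℤ} {r c : ℤ} (h1 : c ≠ j) (h2 : c ≠ j + 1) :
    swapRows j R (r, c) = (r, c) := by
  simp [swapRows, Equiv.swap_apply_of_ne_of_ne h1 h2]

theorem swapRows_fst (j : ℤ) (R : Finset ℤ) (p : ℤ × ℤ) : (swapRows j R p).1 = p.1 := by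
  unfold swapRows
  split_ifs <;> rfl

/-- The effect of a step on the red checkers in column `j`. -/
theorem red_left_flowStep {P : Board} {j i r : ℤ} (hinv : P.FlowInv j) (h : P.IsLowest j i)
    (hr : (r, j) ∈ (P.flowStep j).red) : (r, j) ∈ P.red ∧ r < i := by
  have hlast : ∀ r, r ≤ i → (r, j + 1) ∉ P.red := fun r hri hr => by
    have := hinv i r h.1 hr
    omega
  by_cases ho : (i, j + 1) ∈ P.occ
  · rw [flowStep_small h ho, mem_image_swapRows] at hr
    by_cases hri : r = i
    · subst hri
      rw [swapRows_left (by simp)] at hr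
      exact absurd hr (hlast _ le_rfl)
    · rw [swapRows_of_notMem (by simpa using hri)] at hr
      exact ⟨hr, lt_of_le_of_ne (h.2 _ hr) hri⟩
  · rw [flowStep_big h ho rfl, Finset.mem_insert, mem_image_swapRows] at hr
    rcases hr with hr | hr
    · simp at hr
    · by_cases hri : r ∈ Finset.Ioo (P.emptyAbove i j) i
      · rw [swapRows_left hri] at hr
        exact absurd (Finset.mem_of_mem_erase hr) (hlast _ (Finset.mem_Ioo.1 hri).2.le)
      · rw [swapRows_of_notMem hri] at hr
        have h1 := Finset.mem_of_mem_erase hr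
        refine ⟨h1, lt_of_le_of_ne (h.2 _ h1) ?_⟩
        rintro rfl
        simp at hr

/-- The effect of a step on the red checkers outside of column `j`. -/
theorem red_flowStep {P : Board} {j : ℤ} {p : ℤ × ℤ} (hp : p ∈ (P.flowStep j).red) :
    p.2 = j ∨ p.2 = j + 1 ∨ p ∈ P.red := by
  obtain ⟨r, c⟩ := p
  by_cases hj : c = j
  · exact Or.inl hj
  by_cases hj' : c = j + 1
  · exact Or.inr (Or.inl hj')
  refine Or.inr (Or.inr ?_)
  by_cases hne : ∃ r, (r, j) ∈ P.red
  · obtain ⟨i, h⟩ := exists_isLowest hne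
    by_cases ho : (i, j + 1) ∈ P.occ
    · rw [flowStep_small h ho, mem_image_swapRows, swapRows_of_ne hj hj'] at hp
      exact hp
    · rw [flowStep_big h ho rfl, Finset.mem_insert, mem_image_swapRows,
        swapRows_of_ne hj hj'] at hp
      rcases hp with hp | hp
      · simp [hj'] at hp
      · exact Finset.mem_of_mem_erase hp
  · push Not at hne
    rwa [flowStep_of_empty hne] at hp

/-- A step keeps the rows of the black checkers. -/
theorem black_row_flowStep {P : Board} {j : ℤ} {p : ℤ × ℤ} (hp : p ∈ (P.flowStep j).black) :
    ∃ q ∈ P.black, q.1 = p.1 := by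
  by_cases hne : ∃ r, (r, j) ∈ P.red
  · obtain ⟨i, h⟩ := exists_isLowest hne
    by_cases ho : (i, j + 1) ∈ P.occ
    · rw [flowStep_small h ho, mem_image_swapRows] at hp
      exact ⟨_, hp, swapRows_fst _ _ _⟩
    · rw [flowStep_big h ho rfl, mem_image_swapRows] at hp
      exact ⟨_, hp, swapRows_fst _ _ _⟩
  · push Not at hne
    rw [flowStep_of_empty hne] at hp
    exact ⟨p, hp, rfl⟩

/-- Every antidiagonal that is occupied after a step was occupied before it. -/
theorem diag_flowStep {P : Board} {j : ℤ} {p : ℤ × ℤ} (hp : p ∈ (P.flowStep j).occ) :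
    ∃ q ∈ P.occ, q.1 + q.2 = p.1 + p.2 := by
  by_cases hne : ∃ r, (r, j) ∈ P.red
  · obtain ⟨i, h⟩ := exists_isLowest hne
    have hi : (i, j) ∈ P.occ := mem_occ.2 (Or.inr h.1)
    obtain ⟨r, c⟩ := p
    by_cases ho : (i, j + 1) ∈ P.occ
    · have hp' : swapRows j {i} (r, c) ∈ P.occ := by
        rw [flowStep_small h ho, mem_occ, mem_image_swapRows, mem_image_swapRows] at hp
        exact mem_occ.2 hp
      by_cases hr : r = i
      · subst hr
        by_cases hc : c = j
        · subst hc
          exact ⟨_, hi, rfl⟩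
        by_cases hc' : c = j + 1
        · subst hc'
          exact ⟨_, ho, rfl⟩
        rw [swapRows_of_ne hc hc'] at hp'
        exact ⟨_, hp', rfl⟩
      · rw [swapRows_of_notMem (by simpa using hr)] at hp'
        exact ⟨_, hp', rfl⟩
    · have hlad : ∀ r, P.emptyAbove i j < r → r ≤ i → (r, j) ∈ P.occ := fun r h1 h2 => by
        rcases h2.lt_or_eq with h2 | rfl
        · exact mem_occ_of_emptyAbove_lt h1 h2
        · exact hi
      have hlt := P.emptyAbove_lt i j
      have hp' : (r, c) = (P.emptyAbove i j, j + 1) ∨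
          swapRows j (Finset.Ioo (P.emptyAbove i j) i) (r, c) ∈ P.occ := by
        rw [flowStep_big h ho rfl, mem_occ, mem_image_swapRows, Finset.mem_insert,
          mem_image_swapRows] at hp
        rcases hp with hp | hp | hp
        · exact Or.inr (mem_occ.2 (Or.inl hp))
        · exact Or.inl hp
        · exact Or.inr (mem_occ.2 (Or.inr (Finset.mem_of_mem_erase hp)))
      rcases hp' with hp' | hp'
      · rw [hp']
        exact ⟨_, hlad (P.emptyAbove i j + 1) (by omega) (by omega), by simp; ring⟩
      by_cases hr : r ∈ Finset.Ioo (P.emptyAbove i j) i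
      · rw [Finset.mem_Ioo] at hr
        by_cases hc : c = j
        · subst hc
          exact ⟨_, hlad r hr.1 hr.2.le, rfl⟩
        by_cases hc' : c = j + 1
        · subst hc'
          exact ⟨_, hlad (r + 1) (by omega) (by omega), by simp; ring⟩
        rw [swapRows_of_ne hc hc'] at hp'
        exact ⟨_, hp', rfl⟩
      · rw [swapRows_of_notMem hr] at hp'
        exact ⟨_, hp', rfl⟩
  · push Not at hne
    rw [flowStep_of_empty hne] at hp
    exact ⟨p, hp, rfl⟩

theorem red_right_flowStep {P : Board} {j i r : ℤ} (h : P.IsLowest j i)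
    (hr : (r, j + 1) ∈ (P.flowStep j).red) :
    (r, j + 1) ∈ P.red ∨ (r, j) ∈ P.red ∨
      ((i, j + 1) ∉ P.occ ∧ r = P.emptyAbove i j) := by
  by_cases ho : (i, j + 1) ∈ P.occ
  · rw [flowStep_small h ho, mem_image_swapRows] at hr
    by_cases hri : r = i
    · subst hri
      exact Or.inr (Or.inl h.1)
    · rw [swapRows_of_notMem (by simpa using hri)] at hr
      exact Or.inl hr
  · rw [flowStep_big h ho rfl, Finset.mem_insert, mem_image_swapRows] at hr
    rcases hr with hr | hr
    · exact Or.inr (Or.inr ⟨ho, by simpa using hr⟩)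
    · by_cases hri : r ∈ Finset.Ioo (P.emptyAbove i j) i
      · rw [swapRows_right hri] at hr
        exact Or.inr (Or.inl (Finset.mem_of_mem_erase hr))
      · rw [swapRows_of_notMem hri] at hr
        exact Or.inl (Finset.mem_of_mem_erase hr)

/-- After a step in a big ladder, the red checkers left in column `j` are above the ladder. -/
theorem red_left_lt_emptyAbove {P : Board} {j i r : ℤ} (hinv : P.FlowInv j) (h : P.IsLowest j i)
    (ho : (i, j + 1) ∉ P.occ) (hr : (r, j) ∈ (P.flowStep j).red) : r < P.emptyAbove i j := by
  obtain ⟨h1, h2⟩ := red_left_flowStep hinv h hr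
  rw [flowStep_big h ho rfl, Finset.mem_insert, mem_image_swapRows] at hr
  rcases hr with hr | hr
  · simp at hr
  by_contra! hle
  rcases hle.lt_or_eq with hlt | heq
  · rw [swapRows_left (Finset.mem_Ioo.2 ⟨hlt, h2⟩)] at hr
    have := hinv i r h.1 (Finset.mem_of_mem_erase hr)
    omega
  · exact P.emptyAbove_notMem i j (heq ▸ mem_occ.2 (Or.inr h1))

theorem FlowInv.flowStep {P : Board} {j : ℤ} (hinv : P.FlowInv j) :
    (P.flowStep j).FlowInv j := by
  intro a b ha hb
  by_cases hne : ∃ r, (r, j) ∈ P.red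
  · obtain ⟨i, h⟩ := exists_isLowest hne
    obtain ⟨ha1, ha2⟩ := red_left_flowStep hinv h ha
    by_cases ho : (i, j + 1) ∈ P.occ
    · rw [flowStep_small h ho, mem_image_swapRows] at hb
      by_cases hb' : b = i
      · omega
      · rw [swapRows_of_notMem (by simpa using hb')] at hb
        exact hinv _ _ ha1 hb
    · have hae := red_left_lt_emptyAbove hinv h ho ha
      rw [flowStep_big h ho rfl, Finset.mem_insert, mem_image_swapRows] at hb
      rcases hb with hb | hb
      · simp only [Prod.mk.injEq, and_true] at hb
        omega
      · by_cases hb' : b ∈ Finset.Ioo (P.emptyAbove i j) i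
        · rw [Finset.mem_Ioo] at hb'
          omega
        · rw [swapRows_of_notMem hb'] at hb
          exact hinv _ _ ha1 (Finset.mem_of_mem_erase hb)
  · push Not at hne
    rw [flowStep_of_empty hne] at ha
    exact absurd ha (hne _)

theorem card_redRows_flowStep {P : Board} {j : ℤ} (hinv : P.FlowInv j) :
    ((P.flowStep j).redRows j).card ≤ (P.redRows j).card - 1 := by
  by_cases hne : ∃ r, (r, j) ∈ P.red
  · obtain ⟨i, h⟩ := exists_isLowest hne
    rw [← Finset.card_erase_of_mem (mem_redRows.2 h.1)]
    refine Finset.card_le_card fun r hr => ?_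
    obtain ⟨h1, h2⟩ := red_left_flowStep hinv h (mem_redRows.1 hr)
    exact Finset.mem_erase.2 ⟨h2.ne, mem_redRows.2 h1⟩
  · push Not at hne
    rw [flowStep_of_empty hne]
    have : P.redRows j = ∅ := Finset.eq_empty_of_forall_notMem fun r hr => hne r (mem_redRows.1 hr)
    simp [this]

theorem flowInv_iterate {P : Board} {j : ℤ} (hinv : P.FlowInv j) (k : ℕ) :
    ((Board.flowStep j)^[k] P).FlowInv j := by
  induction k with
  | zero => exact hinv
  | succ k ih =>
    rw [Function.iterate_succ_apply']
    exact ih.flowStep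

theorem card_redRows_iterate {P : Board} {j : ℤ} (hinv : P.FlowInv j) (k : ℕ) :
    (((Board.flowStep j)^[k] P).redRows j).card ≤ (P.redRows j).card - k := by
  induction k with
  | zero => simp
  | succ k ih =>
    rw [Function.iterate_succ_apply']
    have := card_redRows_flowStep (flowInv_iterate hinv k)
    omega

theorem iterate_of_empty {P : Board} {j : ℤ} (h : ∀ r, (r, j) ∉ P.red) (k : ℕ) :
    (Board.flowStep j)^[k] P = P :=
  Function.iterate_fixed (flowStep_of_empty h) k

theorem flowInv_of_empty {P : Board} {j : ℤ} (h : ∀ r, (r, j + 1) ∉ P.red) : P.FlowInv j :=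
  fun _ b _ hb => absurd hb (h b)

theorem flowCol_of_empty {P : Board} {j : ℤ} (h : ∀ r, (r, j) ∉ P.red) : P.flowCol j = P :=
  iterate_of_empty h _

theorem red_left_flowCol {P : Board} {j : ℤ} (h : ∀ r, (r, j + 1) ∉ P.red) (r : ℤ) :
    (r, j) ∉ (P.flowCol j).red := by
  intro hr
  have h1 := card_redRows_iterate (flowInv_of_empty h) (P.redRows j).card
  have h2 : 0 < ((P.flowCol j).redRows j).card := Finset.card_pos.2 ⟨r, mem_redRows.2 hr⟩
  rw [flowCol] at h2
  omega

theorem flowCol_eq_iterate {P : Board} {j : ℤ} (h : ∀ r, (r, j + 1) ∉ P.red) {k : ℕ}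
    (hk : (P.redRows j).card ≤ k) : P.flowCol j = (Board.flowStep j)^[k] P := by
  obtain ⟨l, rfl⟩ := Nat.exists_eq_add_of_le' hk
  rw [Function.iterate_add_apply]
  exact (iterate_of_empty (red_left_flowCol h) l).symm

theorem red_flowStep_col {P : Board} {j : ℤ} {p : ℤ × ℤ} (hp : p ∈ (P.flowStep j).red) :
    (p.2 = j ∧ ∃ r, (r, j) ∈ P.red) ∨ (p.2 = j + 1 ∧ ∃ r, (r, j) ∈ P.red) ∨ p ∈ P.red := by
  by_cases hne : ∃ r, (r, j) ∈ P.red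
  · rcases red_flowStep hp with h | h | h
    · exact Or.inl ⟨h, hne⟩
    · exact Or.inr (Or.inl ⟨h, hne⟩)
    · exact Or.inr (Or.inr h)
  · push Not at hne
    rw [flowStep_of_empty hne] at hp
    exact Or.inr (Or.inr hp)

theorem red_iterate {P : Board} {j : ℤ} (k : ℕ) {p : ℤ × ℤ}
    (hp : p ∈ ((Board.flowStep j)^[k] P).red) :
    (p.2 = j ∧ ∃ r, (r, j) ∈ P.red) ∨ (p.2 = j + 1 ∧ ∃ r, (r, j) ∈ P.red) ∨ p ∈ P.red := by
  induction k generalizing p with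
  | zero => exact Or.inr (Or.inr hp)
  | succ k ih =>
    rw [Function.iterate_succ_apply'] at hp
    have hex : (∃ r, (r, j) ∈ ((Board.flowStep j)^[k] P).red) → ∃ r, (r, j) ∈ P.red := by
      rintro ⟨r, hr⟩
      rcases ih hr with h | h | h
      · exact h.2
      · exact h.2
      · exact ⟨r, h⟩
    rcases red_flowStep_col hp with h | h | h
    · exact Or.inl ⟨h.1, hex h.2⟩
    · exact Or.inr (Or.inl ⟨h.1, hex h.2⟩)
    · exact ih h

theorem red_flowCol {P : Board} {j : ℤ} (h : ∀ r, (r, j + 1) ∉ P.red) {p : ℤ × ℤ}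
    (hp : p ∈ (P.flowCol j).red) :
    (p.2 = j + 1 ∧ ∃ r, (r, j) ∈ P.red) ∨ (p.2 ≠ j ∧ p ∈ P.red) := by
  have hj : p.2 ≠ j := fun hj => red_left_flowCol h p.1 (hj ▸ hp)
  rcases red_iterate _ hp with h | h | h
  · exact absurd h.1 hj
  · exact Or.inl h
  · exact Or.inr ⟨hj, h⟩

/-! ### Undoing a column -/

theorem flowStep_rot_flowStep {P : Board} {j i : ℤ} (hinv : P.FlowInv j) (h : P.IsLowest j i) :
    (P.flowStep j).rot.flowStep (-(j + 1)) = P.rot := by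
  have hcol : -(j + 1) + 1 = -j := by ring
  have hswap : ∀ (R R' : Finset ℤ), (∀ r, r ∈ R' ↔ -r ∈ R) → ∀ p : ℤ × ℤ,
      -(swapRows (-(j + 1)) R' p) = swapRows j R (-p) := by
    rintro R R' hR ⟨r, c⟩
    by_cases hr : -r ∈ R
    · have hr' := (hR r).2 hr
      by_cases hc : c = -j
      · subst hc
        have h1 := swapRows_right (j := -(j + 1)) hr'
        rw [hcol] at h1
        rw [h1]
        simp only [Prod.neg_mk, neg_neg]
        rw [swapRows_left hr]
      by_cases hc' : c = -(j + 1)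
      · subst hc'
        rw [swapRows_left hr', hcol]
        simp only [Prod.neg_mk, neg_neg]
        rw [swapRows_right hr]
      · rw [swapRows_of_ne hc' (by omega), Prod.neg_mk, swapRows_of_ne (by omega) (by omega)]
    · rw [swapRows_of_notMem (mt (hR r).1 hr), Prod.neg_mk, swapRows_of_notMem hr]
  have hlast : ∀ r, r ≤ i → (r, j + 1) ∉ P.red := fun r hri hr => by
    have := hinv i r h.1 hr
    omega
  by_cases ho : (i, j + 1) ∈ P.occ
  · have hQ := flowStep_small h ho
    set Q := P.flowStep j with hQdef
    have hlow : Q.rot.IsLowest (-(j + 1)) (-i) := by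
      constructor
      · rw [mem_red_rot, hQ, mem_image_swapRows, Prod.neg_mk, neg_neg, neg_neg,
          swapRows_right (by simp)]
        exact h.1
      · intro r hr
        rw [mem_red_rot, hQ, mem_image_swapRows, Prod.neg_mk, neg_neg] at hr
        by_contra! hlt
        rw [swapRows_of_notMem (by simp; omega)] at hr
        exact hlast _ (by omega) hr
    have ho' : (-i, -(j + 1) + 1) ∈ Q.rot.occ := by
      rw [mem_occ_rot, hcol, Prod.neg_mk, neg_neg, neg_neg, hQ, mem_occ, mem_image_swapRows,
        mem_image_swapRows, swapRows_left (by simp)]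
      exact mem_occ.1 ho
    rw [flowStep_small hlow ho']
    have hs := hswap {i} {-i} (by intro r; simp; omega)
    ext p
    · rw [mem_image_swapRows, mem_black_rot, mem_black_rot, hs, hQ, mem_image_swapRows,
        swapRows_swapRows]
    · rw [mem_image_swapRows, mem_red_rot, mem_red_rot, hs, hQ, mem_image_swapRows,
        swapRows_swapRows]
  · obtain ⟨e, he⟩ : ∃ e, P.emptyAbove i j = e := ⟨_, rfl⟩
    have hei : e < i := he ▸ P.emptyAbove_lt i j
    have hemp : (e, j) ∉ P.occ := he ▸ P.emptyAbove_notMem i j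
    have hlad : ∀ r, e < r → r < i → (r, j) ∈ P.occ := fun r h1 h2 =>
      mem_occ_of_emptyAbove_lt (he ▸ h1) h2
    have hQ := flowStep_big h ho he
    set Q := P.flowStep j with hQdef
    have heR : e ∉ Finset.Ioo e i := by simp
    have hiR : i ∉ Finset.Ioo e i := by simp
    have hlow : Q.rot.IsLowest (-(j + 1)) (-e) := by
      constructor
      · rw [mem_red_rot, hQ, Prod.neg_mk, neg_neg, neg_neg]
        exact Finset.mem_insert_self _ _
      · intro r hr
        rw [mem_red_rot, hQ, Prod.neg_mk, neg_neg] at hr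
        by_contra! hlt
        rw [Finset.mem_insert, mem_image_swapRows, swapRows_of_notMem (by simp; omega)] at hr
        rcases hr with hr | hr
        · simp only [Prod.mk.injEq, and_true] at hr
          omega
        · exact hlast _ (by omega) (Finset.mem_of_mem_erase hr)
    have ho' : (-e, -(j + 1) + 1) ∉ Q.rot.occ := by
      rw [mem_occ_rot, hcol, Prod.neg_mk, neg_neg, neg_neg, hQ, mem_occ, mem_image_swapRows,
        Finset.mem_insert, mem_image_swapRows, swapRows_of_notMem heR]
      rintro (h1 | h1 | h1)
      · exact hemp (mem_occ.2 (Or.inl h1))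
      · simp at h1
      · exact hemp (mem_occ.2 (Or.inr (Finset.mem_of_mem_erase h1)))
    have he' : Q.rot.emptyAbove (-e) (-(j + 1)) = -i := by
      refine emptyAbove_eq (by omega) ?_ ?_
      · rw [mem_occ_rot, Prod.neg_mk, neg_neg, neg_neg, hQ, mem_occ, mem_image_swapRows,
          Finset.mem_insert, mem_image_swapRows, swapRows_of_notMem hiR]
        rintro (h1 | h1 | h1)
        · exact ho (mem_occ.2 (Or.inl h1))
        · simp only [Prod.mk.injEq, and_true] at h1
          omega
        · exact ho (mem_occ.2 (Or.inr (Finset.mem_of_mem_erase h1)))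
      · intro r h1 h2
        have hrR : -r ∈ Finset.Ioo e i := by
          rw [Finset.mem_Ioo]
          omega
        rw [mem_occ_rot, Prod.neg_mk, neg_neg, hQ, mem_occ, mem_image_swapRows,
          Finset.mem_insert, mem_image_swapRows, swapRows_right hrR]
        rcases mem_occ.1 (hlad (-r) (by omega) (by omega)) with h3 | h3
        · exact Or.inl h3
        · refine Or.inr (Or.inr (Finset.mem_erase.2 ⟨?_, h3⟩))
          simp only [ne_eq, Prod.mk.injEq, and_true]
          omega
    rw [flowStep_big hlow ho' he']
    have hs := hswap (Finset.Ioo e i) (Finset.Ioo (-i) (-e))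
      (by intro r; simp only [Finset.mem_Ioo]; omega)
    ext p
    · rw [mem_image_swapRows, mem_black_rot, mem_black_rot, hs, hQ, mem_image_swapRows,
        swapRows_swapRows]
    · rw [hcol, Finset.mem_insert, mem_image_swapRows, Finset.mem_erase, mem_red_rot, mem_red_rot,
        hs, hQ, Finset.mem_insert, mem_image_swapRows, swapRows_swapRows]
      have hfix : swapRows j (Finset.Ioo e i) (e, j + 1) = (e, j + 1) := swapRows_of_notMem heR
      constructor
      · rintro (rfl | ⟨hne, h1 | h1⟩)
        · simpa using h.1
        · exfalso
          apply hne
          have h2 := congrArg (swapRows j (Finset.Ioo e i)) h1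
          rw [swapRows_swapRows, hfix, ← hfix, ← h1] at h2
          have h3 := hs p
          rw [h1] at h3
          rw [← neg_inj, h3]
          simp
        · exact Finset.mem_of_mem_erase h1
      · intro hp
        by_cases hpi : -p = (i, j)
        · left
          rw [← neg_inj, hpi]
          simp
        · right
          refine ⟨?_, Or.inr (Finset.mem_erase.2 ⟨hpi, hp⟩)⟩
          intro h1
          have h2 := hs p
          rw [h1] at h2
          simp only [Prod.neg_mk, neg_neg] at h2
          have h3 := congrArg (swapRows j (Finset.Ioo e i)) h2
          rw [swapRows_swapRows, hfix] at h3
          rw [← h3] at hp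
          exact hlast e hei.le hp

theorem iterate_rot_iterate {j : ℤ} (k : ℕ) : ∀ {P : Board}, P.FlowInv j →
    ∃ r ≤ k, (Board.flowStep (-(j + 1)))^[r] ((Board.flowStep j)^[k] P).rot = P.rot := by
  induction k with
  | zero => exact fun _ => ⟨0, le_rfl, rfl⟩
  | succ k ih =>
    intro P hinv
    by_cases hne : ∃ r, (r, j) ∈ P.red
    · obtain ⟨i, h⟩ := exists_isLowest hne
      obtain ⟨r, hr, heq⟩ := ih hinv.flowStep
      refine ⟨r + 1, by omega, ?_⟩
      rw [Function.iterate_succ_apply (Board.flowStep j), Function.iterate_succ_apply', heq,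
        flowStep_rot_flowStep hinv h]
    · push Not at hne
      exact ⟨0, by omega, by rw [iterate_of_empty hne]; rfl⟩

theorem flowCol_rot_flowCol {P : Board} {j : ℤ} (h : ∀ r, (r, j + 1) ∉ P.red) :
    (P.flowCol j).rot.flowCol (-(j + 1)) = P.rot := by
  obtain ⟨k, hk₁, hk₂⟩ : ∃ k, (P.redRows j).card ≤ k ∧
      ((P.flowCol j).rot.redRows (-(j + 1))).card ≤ k :=
    ⟨_, le_max_left _ _, le_max_right _ _⟩
  have h' : ∀ r, (r, -(j + 1) + 1) ∉ (P.flowCol j).rot.red := by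
    intro r hr
    rw [mem_red_rot, Prod.neg_mk, show -(-(j + 1) + 1) = j by ring] at hr
    exact red_left_flowCol h _ hr
  rw [flowCol_eq_iterate h' hk₂, flowCol_eq_iterate h hk₁]
  obtain ⟨r, hr, heq⟩ := iterate_rot_iterate k (flowInv_of_empty h)
  obtain ⟨l, hl⟩ := Nat.exists_eq_add_of_le' hr
  have hl' : (Board.flowStep (-(j + 1)))^[k] ((Board.flowStep j)^[k] P).rot =
      (Board.flowStep (-(j + 1)))^[l] P.rot := by
    rw [← heq, ← Function.iterate_add_apply, ← hl]
  rw [hl']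
  refine iterate_of_empty (fun s hs => ?_) l
  rw [mem_red_rot, Prod.neg_mk, neg_neg] at hs
  exact h _ hs

/-! ### The full flow -/

theorem flowRange_succ' (P : Board) (M : ℤ) (n : ℕ) :
    P.flowRange M (n + 1) = (P.flowCol M).flowRange (M - 1) n := by
  induction n with
  | zero => simp [flowRange]
  | succ n ih =>
    rw [flowRange, ih, flowRange]
    congr 1
    push_cast
    ring

/-- The columns of the red checkers while the flow is in progress. -/
theorem red_flowRange {P : Board} {M c : ℤ} (hM : ∀ p ∈ P.red, p.2 ≤ M)
    (hc : ∀ p ∈ P.red, c ≤ p.2) (n : ℕ) :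
    ∀ p ∈ (P.flowRange M n).red,
      c ≤ p.2 ∧ p.2 ≠ M - n + 1 ∧ (M - n < p.2 → c + 1 ≤ p.2) := by
  induction n with
  | zero =>
    intro p hp
    have h1 := hM p hp
    have h2 := hc p hp
    simp only [Nat.cast_zero]
    omega
  | succ n ih =>
    intro p hp
    have hemp : ∀ r, (r, M - n + 1) ∉ (P.flowRange M n).red := fun r hr => (ih _ hr).2.1 rfl
    rw [flowRange] at hp
    push_cast
    rcases red_flowCol hemp hp with ⟨h1, r, hr⟩ | ⟨h1, h2⟩
    · have := (ih _ hr).1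
      simp only at this
      omega
    · have := ih _ h2
      omega

theorem flowRange_rot_flowRange {P : Board} {M : ℤ} (hM : ∀ p ∈ P.red, p.2 ≤ M) (n : ℕ) :
    (P.flowRange M n).rot.flowRange (n - M - 2) n = P.rot := by
  obtain ⟨c, hc⟩ : ∃ c : ℤ, ∀ p ∈ P.red, c ≤ p.2 := by
    refine ⟨-(P.redBound : ℤ), fun p hp => ?_⟩
    have : p.2.natAbs ≤ P.redBound := Finset.le_sup (f := fun p : ℤ × ℤ => p.2.natAbs) hp
    omega
  induction n with
  | zero => rfl
  | succ n ih =>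
    have hemp : ∀ r, (r, M - n + 1) ∉ (P.flowRange M n).red :=
      fun r hr => (red_flowRange hM hc n _ hr).2.1 rfl
    rw [flowRange_succ', flowRange]
    have h := flowCol_rot_flowCol hemp
    rw [show (((n + 1 : ℕ) : ℤ) - M - 2) = -(M - n + 1) by push_cast; ring, h,
      show -(M - n + 1) - 1 = n - M - 2 by ring, ih]

theorem flowRange_top {P : Board} {M : ℤ} (hM : ∀ p ∈ P.red, p.2 ≤ M) (k n : ℕ) :
    P.flowRange (M + k) (n + k) = P.flowRange M n := by
  induction k with
  | zero => simp
  | succ k ih =>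
    rw [← add_assoc, flowRange_succ', flowCol_of_empty, ← ih]
    · congr 1
      push_cast
      ring
    · intro r hr
      have := hM _ hr
      push_cast at this
      omega

theorem flowRange_bot {P : Board} {M : ℤ} (hM : ∀ p ∈ P.red, p.2 ≤ M) {n : ℕ}
    (hn : ∀ p ∈ P.red, M - n < p.2) (k : ℕ) :
    P.flowRange M (n + k) = P.flowRange M n := by
  induction k with
  | zero => rfl
  | succ k ih =>
    rw [← add_assoc, flowRange, flowCol_of_empty, ih]
    intro r hr
    have := (red_flowRange hM (c := M - n + 1) (fun p hp => by have := hn p hp; omega) _ _ hr).1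
    push_cast at this
    omega

/-- The flow does not depend on the range of columns, as long as it covers all red checkers. -/
theorem flow_eq_flowRange {P : Board} {M : ℤ} (hM : ∀ p ∈ P.red, p.2 ≤ M) {n : ℕ}
    (hn : ∀ p ∈ P.red, M - n < p.2) : P.flow = P.flowRange M n := by
  have hb : ∀ p ∈ P.red, p.2.natAbs ≤ P.redBound := fun p hp =>
    Finset.le_sup (f := fun p : ℤ × ℤ => p.2.natAbs) hp
  have hM' : ∀ p ∈ P.red, p.2 ≤ (P.redBound : ℤ) := fun p hp => by
    have := hb p hp
    omega
  have hn' : ∀ p ∈ P.red, (P.redBound : ℤ) - (2 * P.redBound + 1 : ℕ) < p.2 := fun p hp => by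
    have := hb p hp
    push_cast
    omega
  have key : ∀ (M₁ M₂ : ℤ) (n₁ n₂ : ℕ), (∀ p ∈ P.red, p.2 ≤ M₁) → (∀ p ∈ P.red, p.2 ≤ M₂) →
      (∀ p ∈ P.red, M₁ - n₁ < p.2) → (∀ p ∈ P.red, M₂ - n₂ < p.2) → M₁ ≤ M₂ →
      P.flowRange M₁ n₁ = P.flowRange M₂ n₂ := by
    intro M₁ M₂ n₁ n₂ h1 h2 h3 h4 hle
    obtain ⟨k, hk⟩ := Int.le.dest hle
    rw [← flowRange_top h1 k n₁, hk,
      ← flowRange_bot h2 (n := n₁ + k) (fun p hp => by have := h3 p hp; push_cast; omega) n₂,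
      ← flowRange_bot h2 h4 (n₁ + k), add_comm]
  rcases le_total (P.redBound : ℤ) M with hle | hle
  · exact key _ _ _ _ hM' hM hn' hn hle
  · exact (key _ _ _ _ hM hM' hn hn' hle).symm

theorem red_flow {P : Board} {c : ℤ} (hc : ∀ p ∈ P.red, c ≤ p.2) :
    ∀ p ∈ P.flow.red, c + 1 ≤ p.2 := by
  have hb : ∀ p ∈ P.red, p.2.natAbs ≤ P.redBound := fun p hp =>
    Finset.le_sup (f := fun p : ℤ × ℤ => p.2.natAbs) hp
  intro p hp
  have h := red_flowRange (P := P) (M := P.redBound) (c := max c (-P.redBound))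
    (fun p hp => by have := hb p hp; omega)
    (fun p hp => by have := hb p hp; have := hc p hp; omega) _ p hp
  push_cast at h
  omega

theorem flow_rot_flow (P : Board) : P.flow.rot.flow = P.rot := by
  have hb : ∀ p ∈ P.red, p.2.natAbs ≤ P.redBound := fun p hp =>
    Finset.le_sup (f := fun p : ℤ × ℤ => p.2.natAbs) hp
  have hb' : ∀ p ∈ P.flow.red, p.2.natAbs ≤ P.flow.redBound := fun p hp =>
    Finset.le_sup (f := fun p : ℤ × ℤ => p.2.natAbs) hp
  obtain ⟨M, hM, hM'⟩ : ∃ M : ℤ, (P.redBound : ℤ) ≤ M ∧ (P.flow.redBound : ℤ) ≤ M :=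
    ⟨max P.redBound P.flow.redBound, le_max_left _ _, le_max_right _ _⟩
  have hM0 : 0 ≤ M := by omega
  set n : ℕ := (2 * M + 2).toNat with hn
  have hnM : (n : ℤ) = 2 * M + 2 := by omega
  have h1 : ∀ p ∈ P.red, p.2 ≤ M := fun p hp => by have := hb p hp; omega
  have heq : P.flow = P.flowRange M n :=
    flow_eq_flowRange h1 (fun p hp => by have := hb p hp; omega)
  rw [flow_eq_flowRange (P := P.flow.rot) (M := n - M - 2) (n := n), heq,
    flowRange_rot_flowRange h1]
  · intro p hp
    have := hb' _ (mem_red_rot.1 hp)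
    simp only [Prod.snd_neg, Int.natAbs_neg] at this
    omega
  · intro p hp
    have := hb' _ (mem_red_rot.1 hp)
    simp only [Prod.snd_neg, Int.natAbs_neg] at this
    omega

theorem black_row_flow {P : Board} {p : ℤ × ℤ} (hp : p ∈ P.flow.black) :
    ∃ q ∈ P.black, q.1 = p.1 := by
  have hit : ∀ (j : ℤ) (k : ℕ) (P : Board), ∀ p ∈ ((Board.flowStep j)^[k] P).black,
      ∃ q ∈ P.black, q.1 = p.1 := by
    intro j k P
    induction k with
    | zero => exact fun p hp => ⟨p, hp, rfl⟩
    | succ k ih =>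
      intro p hp
      rw [Function.iterate_succ_apply'] at hp
      obtain ⟨q, hq, h1⟩ := black_row_flowStep hp
      obtain ⟨q', hq', h2⟩ := ih q hq
      exact ⟨q', hq', h2.trans h1⟩
  have hrg : ∀ (M : ℤ) (n : ℕ), ∀ p ∈ (P.flowRange M n).black, ∃ q ∈ P.black, q.1 = p.1 := by
    intro M n
    induction n with
    | zero => exact fun p hp => ⟨p, hp, rfl⟩
    | succ n ih =>
      intro p hp
      obtain ⟨q, hq, h1⟩ := hit _ _ _ p hp
      obtain ⟨q', hq', h2⟩ := ih q hq
      exact ⟨q', hq', h2.trans h1⟩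
  exact hrg _ _ p hp

theorem diag_flow {P : Board} {p : ℤ × ℤ} (hp : p ∈ P.flow.occ) :
    ∃ q ∈ P.occ, q.1 + q.2 = p.1 + p.2 := by
  have hit : ∀ (j : ℤ) (k : ℕ) (P : Board), ∀ p ∈ ((Board.flowStep j)^[k] P).occ,
      ∃ q ∈ P.occ, q.1 + q.2 = p.1 + p.2 := by
    intro j k P
    induction k with
    | zero => exact fun p hp => ⟨p, hp, rfl⟩
    | succ k ih =>
      intro p hp
      rw [Function.iterate_succ_apply'] at hp
      obtain ⟨q, hq, h1⟩ := diag_flowStep hp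
      obtain ⟨q', hq', h2⟩ := ih q hq
      exact ⟨q', hq', h2.trans h1⟩
  have hrg : ∀ (M : ℤ) (n : ℕ), ∀ p ∈ (P.flowRange M n).occ,
      ∃ q ∈ P.occ, q.1 + q.2 = p.1 + p.2 := by
    intro M n
    induction n with
    | zero => exact fun p hp => ⟨p, hp, rfl⟩
    | succ n ih =>
      intro p hp
      obtain ⟨q, hq, h1⟩ := hit _ _ _ p hp
      obtain ⟨q', hq', h2⟩ := ih q hq
      exact ⟨q', hq', h2.trans h1⟩
  exact hrg _ _ p hp

/-- `Y⁺` as a permutation of the set of boards; its inverse is `Y⁻`. -/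
noncomputable def flowEquiv : Equiv.Perm Board where
  toFun := flow
  invFun P := P.rot.flow.rot
  left_inv P := by simp only [flow_rot_flow, rot_rot]
  right_inv P := by simp only [flow_rot_flow, rot_rot]

end Board

/-- A pipe dream: a finite subset of the half-plane `{(i, j) | i + j - 1 ≥ 1}`. -/
def PipeDream : Type := {P : Finset (ℤ × ℤ) // ∀ p ∈ P, 1 ≤ p.1 + p.2 - 1}

namespace PipeDream

/-- The set of positions of the checkers of a pipe dream. -/
def cells (P : PipeDream) : Finset (ℤ × ℤ) := P.1

theorem cells_half (P : PipeDream) : ∀ p ∈ P.cells, 1 ≤ p.1 + p.2 - 1 := P.2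

@[ext]
theorem ext {P Q : PipeDream} (h : P.cells = Q.cells) : P = Q := Subtype.ext h

/-- The transpose `Pᵗ = {(j, i) | (i, j) ∈ P}`. -/
def transpose (P : PipeDream) : PipeDream :=
  ⟨P.cells.image (fun p => (p.2, p.1)), by
    intro p hp
    obtain ⟨q, hq, rfl⟩ := Finset.mem_image.1 hp
    have := P.cells_half q hq
    simp only
    omega⟩

/-- The iterated shift `σᵏ(P) = {(i + k, j - k) | (i, j) ∈ P}`, for any integer `k`. -/
def shift (k : ℤ) (P : PipeDream) : PipeDream :=
  ⟨P.cells.image (fun p => (p.1 + k, p.2 - k)), by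
    intro p hp
    obtain ⟨q, hq, rfl⟩ := Finset.mem_image.1 hp
    have := P.cells_half q hq
    simp only
    omega⟩

end PipeDream

/-- A super pipe dream `(x, y)`: the black checkers are `x`, the red checkers are `y`. -/
@[ext]
structure SuperPipeDream where
  x : PipeDream
  y : PipeDream

namespace SuperPipeDream

/-- The adjoint `(Wₓ, W_y)† = (W_yᵗ, Wₓᵗ)`. -/
def adjoint (W : SuperPipeDream) : SuperPipeDream := ⟨W.y.transpose, W.x.transpose⟩

/-- Super pipe dreams are the boards with all checkers in the half-plane `i + j - 1 ≥ 1`. -/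
def equivBoard : SuperPipeDream ≃ {P : Board // ∀ p ∈ P.occ, 1 ≤ p.1 + p.2 - 1} where
  toFun W := ⟨⟨W.x.cells, W.y.cells⟩, fun p hp =>
    (Board.mem_occ.1 hp).elim (W.x.cells_half p) (W.y.cells_half p)⟩
  invFun P := ⟨⟨P.1.black, fun p hp => P.2 p (Board.mem_occ.2 (Or.inl hp))⟩,
    ⟨P.1.red, fun p hp => P.2 p (Board.mem_occ.2 (Or.inr hp))⟩⟩
  left_inv _ := rfl
  right_inv _ := rfl

theorem flowEquiv_half (P : Board) :
    (∀ p ∈ (Board.flowEquiv P).occ, 1 ≤ p.1 + p.2 - 1) ↔ ∀ p ∈ P.occ, 1 ≤ p.1 + p.2 - 1 := by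
  constructor
  · intro h p hp
    have hp' : -p ∈ P.flow.rot.flow.occ := by
      rw [Board.flow_rot_flow, Board.mem_occ_rot, neg_neg]
      exact hp
    obtain ⟨q, hq, hqp⟩ := Board.diag_flow hp'
    have := h _ (Board.mem_occ_rot.1 hq)
    simp only [Prod.fst_neg, Prod.snd_neg] at this hqp
    omega
  · intro h p hp
    obtain ⟨q, hq, hqp⟩ := Board.diag_flow hp
    have := h q hq
    omega

/-- The flow operator `Y⁺` as a bijection of the set of super pipe dreams. -/
noncomputable def yFlow : Equiv.Perm SuperPipeDream :=
  equivBoard.trans ((Board.flowEquiv.subtypePerm flowEquiv_half).trans equivBoard.symm)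

/-- `Y⁺ W`: every red checker flows to the right by one column. -/
noncomputable def yPlus (W : SuperPipeDream) : SuperPipeDream := yFlow W

/-- `Y⁻`, the inverse of `Y⁺`: every red checker flows to the left by one column. -/
noncomputable def yMinus (W : SuperPipeDream) : SuperPipeDream := yFlow.symm W

/-- Every red checker is strictly northeast of every black checker. -/
def RedNE (W : SuperPipeDream) : Prop :=
  ∀ p ∈ W.y.cells, ∀ q ∈ W.x.cells, p.1 < q.1 ∧ q.2 < p.2

/-- Every red checker is strictly southwest of every black checker. -/
def RedSW (W : SuperPipeDream) : Prop :=
  ∀ p ∈ W.y.cells, ∀ q ∈ W.x.cells, q.1 < p.1 ∧ p.2 < q.2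

/-- The board of a super pipe dream. -/
def toBoard (W : SuperPipeDream) : Board := ⟨W.x.cells, W.y.cells⟩

theorem toBoard_iterate_yPlus (W : SuperPipeDream) (m : ℕ) :
    (yPlus^[m] W).toBoard = Board.flow^[m] W.toBoard := by
  induction m with
  | zero => rfl
  | succ m ih =>
    rw [Function.iterate_succ_apply', Function.iterate_succ_apply', ← ih]
    rfl

theorem toBoard_iterate_yMinus (W : SuperPipeDream) (m : ℕ) :
    (yMinus^[m] W).toBoard = (Board.flow^[m] W.toBoard.rot).rot := by
  induction m with
  | zero => exact (Board.rot_rot _).symm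
  | succ m ih =>
    rw [Function.iterate_succ_apply', Function.iterate_succ_apply',
      ← Board.rot_rot (Board.flow^[m] W.toBoard.rot), ← ih]
    rfl

theorem exists_redNE_board (P : Board) :
    ∃ m : ℕ, ∀ p ∈ (Board.flow^[m] P).red, ∀ q ∈ (Board.flow^[m] P).black,
      p.1 < q.1 ∧ q.2 < p.2 := by
  obtain ⟨B, hB⟩ : ∃ B : ℕ, ∀ p ∈ P.occ, p.1.natAbs ≤ B ∧ p.2.natAbs ≤ B := by
    refine ⟨P.occ.sup (fun p => max p.1.natAbs p.2.natAbs), fun p hp => ?_⟩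
    have := Finset.le_sup (f := fun p : ℤ × ℤ => max p.1.natAbs p.2.natAbs) hp
    exact ⟨(le_max_left _ _).trans this, (le_max_right _ _).trans this⟩
  have key : ∀ m : ℕ,
      (∀ p ∈ (Board.flow^[m] P).red, -(B : ℤ) + m ≤ p.2) ∧
      (∀ p ∈ (Board.flow^[m] P).black, -(B : ℤ) ≤ p.1) ∧
      (∀ p ∈ (Board.flow^[m] P).occ, p.1 + p.2 ≤ 2 * B) := by
    intro m
    induction m with
    | zero =>
      refine ⟨fun p hp => ?_, fun p hp => ?_, fun p hp => ?_⟩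
      · have := hB p (Board.mem_occ.2 (Or.inr hp))
        simp only [Nat.cast_zero]
        omega
      · have := hB p (Board.mem_occ.2 (Or.inl hp))
        omega
      · have := hB p hp
        omega
    | succ m ih =>
      rw [Function.iterate_succ_apply']
      refine ⟨fun p hp => ?_, fun p hp => ?_, fun p hp => ?_⟩
      · have := Board.red_flow ih.1 p hp
        push_cast
        omega
      · obtain ⟨q, hq, h⟩ := Board.black_row_flow hp
        have := ih.2.1 q hq
        omega
      · obtain ⟨q, hq, h⟩ := Board.diag_flow hp
        have := ih.2.2 q hq
        omega
  refine ⟨4 * B + 1, fun p hp q hq => ?_⟩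
  obtain ⟨h1, h2, h3⟩ := key (4 * B + 1)
  have a1 := h1 p hp
  have a2 := h2 q hq
  have a3 := h3 p (Board.mem_occ.2 (Or.inr hp))
  have a4 := h3 q (Board.mem_occ.2 (Or.inl hq))
  push_cast at a1
  omega

/-- After enough applications of `Y⁺` the red checkers are northeast of the black ones. -/
theorem exists_redNE (W : SuperPipeDream) : ∃ m : ℕ, (yPlus^[m] W).RedNE := by
  obtain ⟨m, hm⟩ := exists_redNE_board W.toBoard
  rw [← toBoard_iterate_yPlus] at hm
  exact ⟨m, hm⟩

/-- After enough applications of `Y⁻` the red checkers are southwest of the black ones. -/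
theorem exists_redSW (W : SuperPipeDream) : ∃ m : ℕ, (yMinus^[m] W).RedSW := by
  obtain ⟨m, hm⟩ := exists_redNE_board W.toBoard.rot
  refine ⟨m, fun p hp q hq => ?_⟩
  have hp' : p ∈ (yMinus^[m] W).toBoard.red := hp
  have hq' : q ∈ (yMinus^[m] W).toBoard.black := hq
  rw [toBoard_iterate_yMinus, Board.mem_red_rot] at hp'
  rw [toBoard_iterate_yMinus, Board.mem_black_rot] at hq'
  have := hm _ hp' _ hq'
  simp only [Prod.fst_neg, Prod.snd_neg] at this
  omega

open Classical in
/-- The rectification `(V, U)` of `W`: take `m` such that in `W' = (Y⁺)ᵐ W` the red checkers are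
northeast of the black ones; then `V = W'ₓ` and `Uᵗ = σᵐ(W'_y)`. The least such `m` is used
(any further application of `Y⁺` just applies `σ⁻¹` to the red checkers). -/
noncomputable def rect (W : SuperPipeDream) : PipeDream × PipeDream :=
  let m := Nat.find W.exists_redNE
  let W' := yPlus^[m] W
  (W'.x, (W'.y.shift m).transpose)

open Classical in
/-- The corectification `(V, U)` of `W`: take `m` such that in `W' = (Y⁻)ᵐ W` the red checkers are
southwest of the black ones; then `V = W'ₓ` and `Uᵗ = σ⁻ᵐ(W'_y)`. The least such `m` is used
(any further application of `Y⁻` just applies `σ` to the red checkers). -/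
noncomputable def coRect (W : SuperPipeDream) : PipeDream × PipeDream :=
  let m := Nat.find W.exists_redSW
  let W' := yMinus^[m] W
  (W'.x, (W'.y.shift (-m)).transpose)

end SuperPipeDream

/-!
The flow `Y⁺` turns out to be governed by a local rule. Label the edges of the square grid by bits:
`h i j` on the edge through which the position `(i, j)` is entered from the right, and `v i j` on
the edge through which it is entered from below. The bit `h i j` records a black checker at
`(i, j + 1)` just before column `j` is processed, and `v i j` records that a red checker of column
`j` is being carried upwards past `(i, j)`. Then the contents of `(i, j)` before the flow together
with the two incoming bits determine the contents of `(i, j + 1)` after the flow together with the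
two outgoing bits `h i (j - 1)` and `v (i - 1) j`, by a fixed function `Board.vertex`
(`Board.exists_isLabeling_flow`).

Two features of this function give the result. An empty position has outgoing bits zero, so on a
finite board the labeling, and with it the result of the flow, is determined by the local rule alone
(`Board.IsLabeling.unique`). And the function is invariant under exchanging the two colors together
with the two directions (`Board.vertex_symm`). Hence taking adjoints turns `Y⁺` into `Y⁺` up to a
translation along the antidiagonal: with `W.adjointShift k = ((σᵏ W_y)ᵗ, (σᵏ Wₓ)ᵗ)` one has
`Y⁺ (W.adjointShift k) = (Y⁺ W).adjointShift (k + 1)`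
(`SuperPipeDream.yPlus_adjointShift`). By iteration `(Y⁺)ᵐ W†` is the shifted adjoint of `(Y⁺)ᵐ W`
with `k = m`. The condition that the red checkers are northeast of the black ones is invariant under
shifted adjoints, so the same `m` serves for `W` and `W†`, and the shift by `m` is
the one in the definition of the rectification. The inverse `Y⁻` is treated in the same way.
-/

namespace Board

/-! ### The local rule -/

/-- The local rule of the flow. The arguments say whether a position `(i, j)` holds a black or a red
checker, whether a black checker comes in from the right, and whether a red checker is carried in
from below. The values say whether `(i, j + 1)` holds a black or a red checker after the flow,
whether a black checker goes out to the left, and whether a red checker is carried out upwards. -/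
def vertex (b r h v : Bool) : Bool × Bool × Bool × Bool :=
  if v then (if b || r then (b, r, h, true) else (h, true, false, false))
  else if r then (if h then (b, true, true, false) else (false, false, b, true))
  else (h, false, b, false)

/-- The local rule is invariant under exchanging the colors and reflecting in the diagonal. -/
theorem vertex_symm (b r h v : Bool) :
    vertex r b v h = ((vertex b r h v).2.1, (vertex b r h v).1, (vertex b r h v).2.2.2,
      (vertex b r h v).2.2.1) := by
  revert b r h v
  decide

theorem vertex_empty (h v : Bool) : (vertex false false h v).2.2 = (false, false) := by
  revert h v
  decide

/-- The bits `h i j` and `v i j`, on the edges to the right of and below the position `(i, j)`, obey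
the local rule at every position, with the contents of `P` as input and the contents of `Q`, one
column further to the right, as output. -/
def IsLabeling (P Q : Board) (h v : ℤ → ℤ → Bool) : Prop :=
  ∀ i j, vertex (decide ((i, j) ∈ P.black)) (decide ((i, j) ∈ P.red)) (h i j) (v i j) =
    (decide ((i, j + 1) ∈ Q.black), decide ((i, j + 1) ∈ Q.red), h i (j - 1), v (i - 1) j)

/-- The result of the local rule is determined by `P`: both bits vanish far enough to the lower
right, since empty positions have outgoing bits zero, and from there on the local rule determines
them antidiagonal by antidiagonal. -/
theorem IsLabeling.unique {P Q Q' : Board} {h v h' v' : ℤ → ℤ → Bool}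
    (hQ : P.IsLabeling Q h v) (hQ' : P.IsLabeling Q' h' v') : Q = Q' := by
  obtain ⟨B, hB⟩ : ∃ B : ℕ, ∀ p ∈ P.occ, p.1 + p.2 ≤ B := by
    refine ⟨P.occ.sup (fun p => (p.1 + p.2).natAbs), fun p hp => ?_⟩
    have := Finset.le_sup (f := fun p : ℤ × ℤ => (p.1 + p.2).natAbs) hp
    omega
  have hempty : ∀ {Q h v}, P.IsLabeling Q h v → ∀ i j, (B : ℤ) < i + j →
      h i (j - 1) = false ∧ v (i - 1) j = false := by
    intro Q h v hQ i j hij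
    have hocc : (i, j) ∉ P.occ := fun hp => by
      have := hB _ hp
      simp only at this
      omega
    rw [mem_occ, not_or] at hocc
    have h1 := congrArg (fun t => t.2.2) (hQ i j)
    simp only [hocc.1, hocc.2, decide_false, vertex_empty, Prod.mk.injEq] at h1
    exact ⟨h1.1.symm, h1.2.symm⟩
  have key : ∀ n : ℕ, ∀ i j : ℤ, (B : ℤ) - n ≤ i + j → h i j = h' i j ∧ v i j = v' i j := by
    intro n
    induction n with
    | zero =>
      intro i j hij
      have a1 := (hempty hQ i (j + 1) (by omega)).1
      have a2 := (hempty hQ' i (j + 1) (by omega)).1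
      have a3 := (hempty hQ (i + 1) j (by omega)).2
      have a4 := (hempty hQ' (i + 1) j (by omega)).2
      rw [add_sub_cancel_right] at a1 a2 a3 a4
      exact ⟨a1.trans a2.symm, a3.trans a4.symm⟩
    | succ n ih =>
      intro i j hij
      push_cast at hij
      have a1 := ih i (j + 1) (by omega)
      have a2 := ih (i + 1) j (by omega)
      have b1 := hQ i (j + 1)
      have b2 := hQ (i + 1) j
      rw [a1.1, a1.2, hQ' i (j + 1)] at b1
      rw [a2.1, a2.2, hQ' (i + 1) j] at b2
      simp only [Prod.mk.injEq, add_sub_cancel_right] at b1 b2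
      exact ⟨b1.2.2.1.symm, b2.2.2.2.symm⟩
  have hcell : ∀ i j : ℤ, ((i, j) ∈ Q.black ↔ (i, j) ∈ Q'.black) ∧
      ((i, j) ∈ Q.red ↔ (i, j) ∈ Q'.red) := by
    intro i j
    have a := key (B - (i + (j - 1))).toNat i (j - 1) (by omega)
    have b := hQ i (j - 1)
    rw [a.1, a.2, hQ' i (j - 1)] at b
    simp only [Prod.mk.injEq, sub_add_cancel, decide_eq_decide] at b
    exact ⟨b.1.symm, b.2.1.symm⟩
  ext ⟨i, j⟩
  · exact (hcell i j).1
  · exact (hcell i j).2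

/-! ### The flow obeys the local rule -/

theorem flowStep_of_ne {P : Board} {j : ℤ} {p : ℤ × ℤ} (h1 : p.2 ≠ j) (h2 : p.2 ≠ j + 1) :
    (p ∈ (P.flowStep j).black ↔ p ∈ P.black) ∧ (p ∈ (P.flowStep j).red ↔ p ∈ P.red) := by
  obtain ⟨r, c⟩ := p
  simp only at h1 h2
  by_cases hne : ∃ r, (r, j) ∈ P.red
  · obtain ⟨i, h⟩ := exists_isLowest hne
    by_cases ho : (i, j + 1) ∈ P.occ
    · rw [flowStep_small h ho]
      simp only [mem_image_swapRows, swapRows_of_ne h1 h2, and_self]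
    · rw [flowStep_big h ho rfl]
      simp only [mem_image_swapRows, Finset.mem_insert, Finset.mem_erase, swapRows_of_ne h1 h2,
        Prod.mk.injEq, h1, h2, and_false, false_or, ne_eq, not_false_iff, true_and, and_self]
  · push Not at hne
    rw [flowStep_of_empty hne]
    exact ⟨Iff.rfl, Iff.rfl⟩

theorem flowCol_of_ne {P : Board} {j : ℤ} {p : ℤ × ℤ} (h1 : p.2 ≠ j) (h2 : p.2 ≠ j + 1) :
    (p ∈ (P.flowCol j).black ↔ p ∈ P.black) ∧ (p ∈ (P.flowCol j).red ↔ p ∈ P.red) := by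
  rw [flowCol]
  induction (P.redRows j).card with
  | zero => exact ⟨Iff.rfl, Iff.rfl⟩
  | succ k ih =>
    rw [Function.iterate_succ_apply']
    exact ⟨(flowStep_of_ne h1 h2).1.trans ih.1, (flowStep_of_ne h1 h2).2.trans ih.2⟩

/-- After `k` ladder modifications in column `j`, the rows from some row `t` downwards are finished
and obey the local rule, and the rows above `t` are untouched. -/
theorem exists_vertex_iterate {P : Board} {j : ℤ} (hP : ∀ r, (r, j + 1) ∉ P.red) (k : ℕ) :
    ∃ (v : ℤ → Bool) (t : ℤ), (∀ r < t, v r = false) ∧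
      (∀ r < t, ∀ c, (((r, c) ∈ ((Board.flowStep j)^[k] P).black ↔ (r, c) ∈ P.black) ∧
        ((r, c) ∈ ((Board.flowStep j)^[k] P).red ↔ (r, c) ∈ P.red))) ∧
      (∀ r ≥ t, (r, j) ∉ ((Board.flowStep j)^[k] P).red) ∧
      ∀ r ≥ t, vertex (decide ((r, j) ∈ P.black)) (decide ((r, j) ∈ P.red))
          (decide ((r, j + 1) ∈ P.black)) (v r) =
        (decide ((r, j + 1) ∈ ((Board.flowStep j)^[k] P).black),
          decide ((r, j + 1) ∈ ((Board.flowStep j)^[k] P).red),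
          decide ((r, j) ∈ ((Board.flowStep j)^[k] P).black), v (r - 1)) := by
  induction k with
  | zero =>
    obtain ⟨t, ht⟩ : ∃ t, ∀ r ≥ t, (r, j) ∉ P.red := by
      by_cases hne : ∃ r, (r, j) ∈ P.red
      · obtain ⟨i, h⟩ := exists_isLowest hne
        refine ⟨i + 1, fun r hr hr' => ?_⟩
        have := h.2 r hr'
        omega
      · push Not at hne
        exact ⟨0, fun r _ => hne r⟩
    obtain ⟨Q, hQ⟩ : ∃ Q, Q = (Board.flowStep j)^[0] P := ⟨_, rfl⟩
    rw [← hQ]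
    obtain rfl : Q = P := hQ
    refine ⟨fun _ => false, t, fun _ _ => rfl, fun _ _ _ => ⟨Iff.rfl, Iff.rfl⟩, ht, ?_⟩
    intro r hr
    simp [vertex, ht r hr, hP r]
  | succ k ih =>
    obtain ⟨v, t, hv, habove, hred, hbelow⟩ := ih
    rw [Function.iterate_succ_apply']
    set Q := (Board.flowStep j)^[k] P with hQ
    by_cases hne : ∃ r, (r, j) ∈ Q.red
    swap
    · push Not at hne
      rw [flowStep_of_empty hne]
      exact ⟨v, t, hv, habove, hred, hbelow⟩
    obtain ⟨i, h⟩ := exists_isLowest hne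
    have hit : i < t := by
      by_contra! hle
      exact hred i hle h.1
    have hbtw : ∀ r, i < r → (r, j) ∉ Q.red := fun r hr hr' => by
      have := h.2 r hr'
      omega
    have hright : ∀ r < t, (r, j + 1) ∉ Q.red := fun r hr => by
      rw [(habove r hr _).2]
      exact hP r
    -- The next modification finishes the rows from `i`, or from the top `e` of the ladder, to `t - 1`.
    by_cases ho : (i, j + 1) ∈ Q.occ
    · rw [flowStep_small h ho]
      have hfix : ∀ r c, r ≠ i → swapRows j {i} (r, c) = (r, c) := fun r c hr =>
        swapRows_of_notMem (by simpa using hr)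
      refine ⟨v, i, fun r hr => hv r (by omega), fun r hr c => ?_, fun r hr => ?_, fun r hr => ?_⟩
      · simp only [mem_image_swapRows, hfix r _ hr.ne]
        exact habove r (by omega) c
      · rw [mem_image_swapRows]
        rcases eq_or_lt_of_le hr with rfl | hr
        · rw [swapRows_left (by simp)]
          exact hright _ hit
        · rw [hfix r _ hr.ne']
          exact hbtw r hr
      · simp only [mem_image_swapRows]
        rcases eq_or_lt_of_le hr with rfl | hr
        · rw [swapRows_left (by simp), swapRows_right (by simp), hv _ hit, hv _ (by omega)]
          have hb : (i, j + 1) ∈ Q.black := (mem_occ.1 ho).resolve_right (hright _ hit)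
          simp [vertex, ← (habove i hit _).1, ← (habove i hit _).2, hb, h.1]
        · rw [hfix r _ hr.ne', hfix r _ hr.ne']
          rcases le_or_gt t r with hrt | hrt
          · exact hbelow r hrt
          · rw [hv _ hrt, hv _ (by omega)]
            simp [vertex, ← (habove r hrt _).1, ← (habove r hrt _).2, hbtw r hr, hright r hrt]
    · obtain ⟨e, he⟩ : ∃ e, Q.emptyAbove i j = e := ⟨_, rfl⟩
      have hei : e < i := he ▸ Q.emptyAbove_lt i j
      have hemp : (e, j) ∉ Q.occ := he ▸ Q.emptyAbove_notMem i j
      have hlad : ∀ r, e < r → r < i → (r, j) ∈ Q.occ := fun r h1 h2 =>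
        mem_occ_of_emptyAbove_lt (he ▸ h1) h2
      rw [flowStep_big h ho he]
      rw [mem_occ, not_or] at hemp ho
      -- A red checker is carried upwards from row `i` to row `e`.
      refine ⟨fun r => v r || decide (e ≤ r ∧ r < i), e, fun r hr => ?_, fun r hr c => ?_,
        fun r hr => ?_, fun r hr => ?_⟩
      · have her : ¬ (e ≤ r ∧ r < i) := by omega
        simp only [hv r (by omega), her, decide_false, Bool.or_false]
      · simp only [mem_image_swapRows, Finset.mem_insert, Finset.mem_erase,
          swapRows_of_notMem (show r ∉ Finset.Ioo e i by simp; omega), Prod.mk.injEq]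
        rw [(habove r (by omega) c).1, (habove r (by omega) c).2]
        simp [hr.ne, (hr.trans hei).ne]
      · simp only [mem_image_swapRows, Finset.mem_insert, Finset.mem_erase, Prod.mk.injEq]
        by_cases hrR : r ∈ Finset.Ioo e i
        · rw [swapRows_left hrR]
          rw [Finset.mem_Ioo] at hrR
          simp [hright r (by omega)]
        · rw [swapRows_of_notMem hrR]
          rw [Finset.mem_Ioo] at hrR
          rcases lt_trichotomy r i with hlt | rfl | hgt
          · obtain rfl : r = e := by omega
            simp [hemp.2]
          · simp
          · simp [hbtw r hgt]
      · simp only [mem_image_swapRows, Finset.mem_insert, Finset.mem_erase, Prod.mk.injEq]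
        by_cases hrR : r ∈ Finset.Ioo e i
        · rw [swapRows_left hrR, swapRows_right hrR]
          rw [Finset.mem_Ioo] at hrR
          have hrt : r < t := by omega
          have hocc := mem_occ.1 (hlad r hrR.1 hrR.2)
          simp only [hv r hrt, hv (r - 1) (by omega), ← (habove r hrt _).1, ← (habove r hrt _).2]
          have h1 : e ≤ r ∧ r < i := by omega
          have h2 : e ≤ r - 1 ∧ r - 1 < i := by omega
          simp [vertex, h1, h2, hocc, hrR.1.ne', hrR.2.ne]
        · rw [swapRows_of_notMem hrR, swapRows_of_notMem hrR]
          rw [Finset.mem_Ioo] at hrR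
          rcases lt_trichotomy r i with hlt | rfl | hgt
          · obtain rfl : r = e := by omega
            have hrt : r < t := by omega
            simp only [hv r hrt, hv (r - 1) (by omega), ← (habove r hrt _).1, ← (habove r hrt _).2]
            simp [vertex, hemp, hlt]
          · simp only [hv r hit, hv (r - 1) (by omega), ← (habove r hit _).1, ← (habove r hit _).2]
            have h2 : e ≤ r - 1 := by omega
            simp [vertex, h.1, ho, hei.ne', h2]
          · have h1 : ¬ (e ≤ r ∧ r < i) := by omega
            have h2 : ¬ (e ≤ r - 1 ∧ r - 1 < i) := by omega
            simp only [h1, h2, decide_false, Bool.or_false]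
            rcases le_or_gt t r with hrt | hrt
            · rw [hbelow r hrt]
              simp [(hei.trans hgt).ne', hgt.ne']
            · rw [hv _ hrt, hv _ (by omega)]
              simp [vertex, ← (habove r hrt _).1, ← (habove r hrt _).2, hbtw r hgt, hright r hrt,
                (hei.trans hgt).ne']

theorem exists_vertex_flowCol {P : Board} {j : ℤ} (hP : ∀ r, (r, j + 1) ∉ P.red) :
    ∃ v : ℤ → Bool, ∀ r, vertex (decide ((r, j) ∈ P.black)) (decide ((r, j) ∈ P.red))
        (decide ((r, j + 1) ∈ P.black)) (v r) =
      (decide ((r, j + 1) ∈ (P.flowCol j).black), decide ((r, j + 1) ∈ (P.flowCol j).red),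
        decide ((r, j) ∈ (P.flowCol j).black), v (r - 1)) := by
  obtain ⟨v, t, hv, habove, -, hbelow⟩ := exists_vertex_iterate hP (P.redRows j).card
  refine ⟨v, fun r => ?_⟩
  rcases le_or_gt t r with hrt | hrt
  · exact hbelow r hrt
  · have hr : (r, j) ∉ P.red := by
      rw [← (habove r hrt j).2]
      exact red_left_flowCol hP r
    rw [hv r hrt, hv (r - 1) (by omega), flowCol]
    simp only [(habove r hrt _).1, (habove r hrt _).2]
    simp [vertex, hr, hP r]

theorem exists_isLabeling_flow (P : Board) : ∃ h v, P.IsLabeling P.flow h v := by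
  have hb : ∀ p ∈ P.red, p.2.natAbs ≤ P.redBound := fun p hp =>
    Finset.le_sup (f := fun p : ℤ × ℤ => p.2.natAbs) hp
  obtain ⟨M, hMdef⟩ : ∃ M : ℤ, M = P.redBound := ⟨_, rfl⟩
  have hM : ∀ p ∈ P.red, p.2 ≤ M := fun p hp => by
    have := hb p hp
    omega
  have hc : ∀ p ∈ P.red, -M ≤ p.2 := fun p hp => by
    have := hb p hp
    omega
  -- `S j` is the board just before column `j` is processed.
  obtain ⟨S, hS⟩ : ∃ S : ℤ → Board, ∀ j, S j = P.flowRange M (M - j).toNat := ⟨_, fun _ => rfl⟩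
  have hSstep : ∀ j, S (j - 1) = (S j).flowCol j := by
    intro j
    rw [hS, hS]
    rcases le_or_gt j M with hj | hj
    · rw [show (M - (j - 1)).toNat = (M - j).toNat + 1 by omega, flowRange,
        show M - ((M - j).toNat : ℤ) = j by omega]
    · rw [show (M - (j - 1)).toNat = 0 by omega, show (M - j).toNat = 0 by omega, flowRange,
        flowCol_of_empty]
      intro r hr
      have := hM _ hr
      simp only at this
      omega
  have hSred : ∀ j r, (r, j + 1) ∉ (S j).red := by
    intro j r hr
    rw [hS] at hr
    rcases le_or_gt j M with hj | hj
    · have := (red_flowRange hM hc _ _ hr).2.1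
      simp only at this
      omega
    · rw [show (M - j).toNat = 0 by omega, flowRange] at hr
      have := hM _ hr
      simp only at this
      omega
  have hSleft : ∀ (k : ℕ) (j : ℤ) (p : ℤ × ℤ), p.2 ≤ j → M - k ≤ j →
      (p ∈ (S j).black ↔ p ∈ P.black) ∧ (p ∈ (S j).red ↔ p ∈ P.red) := by
    intro k
    induction k with
    | zero =>
      intro j p _ hj
      rw [hS, show (M - j).toNat = 0 by push_cast at hj; omega]
      exact ⟨Iff.rfl, Iff.rfl⟩
    | succ k ih =>
      intro j p hp hj
      have h1 := ih (j + 1) p (by omega) (by push_cast at hj; omega)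
      have h2 := flowCol_of_ne (P := S (j + 1)) (j := j + 1) (p := p) (by omega) (by omega)
      rw [← hSstep, add_sub_cancel_right] at h2
      exact ⟨h2.1.trans h1.1, h2.2.trans h1.2⟩
  have hSright : ∀ (k : ℕ) (j : ℤ) (p : ℤ × ℤ), j + 1 < p.2 →
      (p ∈ (S (j - k)).black ↔ p ∈ (S j).black) ∧ (p ∈ (S (j - k)).red ↔ p ∈ (S j).red) := by
    intro k j p hp
    induction k with
    | zero => simp
    | succ k ih =>
      have h2 := flowCol_of_ne (P := S (j - k)) (j := j - k) (p := p) (by omega) (by omega)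
      rw [← hSstep, sub_sub] at h2
      push_cast
      exact ⟨h2.1.trans ih.1, h2.2.trans ih.2⟩
  have hSflow : ∀ j, j < -M → P.flow = S j := by
    intro j hj
    rw [hS]
    refine flow_eq_flowRange hM fun p hp => ?_
    have := hc p hp
    omega
  choose v hv using fun j => exists_vertex_flowCol (hSred j)
  refine ⟨fun i j => decide ((i, j + 1) ∈ (S j).black), fun i j => v j i, fun i j => ?_⟩
  have h1 := hv j i
  have h2 := hSleft (M - j).toNat j (i, j) le_rfl (by omega)
  have h3 := hSright (j + M).toNat (j - 1) (i, j + 1) (by simp)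
  rw [← hSflow _ (by omega)] at h3
  rw [← hSstep] at h1
  simp only [h2.1, h2.2, ← h3.1, ← h3.2] at h1
  simpa only [sub_add_cancel] using h1

/-! ### Shifted adjoints -/

/-- The board of `((σᵏ W_y)ᵗ, (σᵏ Wₓ)ᵗ)`, where `P` is the board of `(Wₓ, W_y)`. -/
def adjointShift (k : ℤ) (P : Board) : Board where
  black := P.red.image (fun p => (p.2 - k, p.1 + k))
  red := P.black.image (fun p => (p.2 - k, p.1 + k))

theorem mem_image_transpose_shift {S : Finset (ℤ × ℤ)} {k i j : ℤ} :
    (i, j) ∈ S.image (fun p : ℤ × ℤ => (p.2 - k, p.1 + k)) ↔ (j - k, i + k) ∈ S := by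
  constructor
  · intro h
    obtain ⟨⟨a, b⟩, hq, h⟩ := Finset.mem_image.1 h
    simp only [Prod.mk.injEq] at h
    rwa [show j - k = a by omega, show i + k = b by omega]
  · intro h
    exact Finset.mem_image.2 ⟨_, h, by simp⟩

theorem IsLabeling.adjointShift {P Q : Board} {h v : ℤ → ℤ → Bool} (hQ : P.IsLabeling Q h v)
    (k : ℤ) : (P.adjointShift k).IsLabeling (Q.adjointShift (k + 1))
      (fun i j => v (j - k) (i + k)) (fun i j => h (j - k) (i + k)) := by
  intro i j
  have h1 := hQ (j - k) (i + k)
  rw [show i + k + 1 = i + (k + 1) by ring, show i + k - 1 = i - 1 + k by ring,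
    show j - k - 1 = j - 1 - k by ring] at h1
  simp only [Board.adjointShift, mem_image_transpose_shift, show j + 1 - (k + 1) = j - k by ring]
  rw [vertex_symm, h1]

/-- The flow commutes with shifted adjoints, up to one more shift. -/
theorem flow_adjointShift (k : ℤ) (P : Board) :
    (P.adjointShift k).flow = P.flow.adjointShift (k + 1) := by
  obtain ⟨h, v, hP⟩ := P.exists_isLabeling_flow
  obtain ⟨h', v', hP'⟩ := (P.adjointShift k).exists_isLabeling_flow
  exact hP'.unique (hP.adjointShift k)

end Board

namespace PipeDream

theorem transpose_shift_transpose_shift (k : ℤ) (P : PipeDream) :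
    (((P.shift k).transpose).shift k).transpose = P := by
  ext p
  simp [transpose, shift, cells, Finset.image_image, Function.comp_def]

end PipeDream

namespace SuperPipeDream

/-- The shifted adjoint `((σᵏ W_y)ᵗ, (σᵏ Wₓ)ᵗ)` of `(Wₓ, W_y)`. -/
def adjointShift (k : ℤ) (W : SuperPipeDream) : SuperPipeDream :=
  ⟨(W.y.shift k).transpose, (W.x.shift k).transpose⟩

theorem adjointShift_zero (W : SuperPipeDream) : W.adjointShift 0 = W.adjoint := by
  ext p <;> simp [adjointShift, adjoint, PipeDream.shift, PipeDream.transpose, PipeDream.cells]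

theorem toBoard_adjointShift (k : ℤ) (W : SuperPipeDream) :
    (W.adjointShift k).toBoard = W.toBoard.adjointShift k := by
  simp only [toBoard, adjointShift, Board.adjointShift, PipeDream.transpose, PipeDream.shift,
    PipeDream.cells, Finset.image_image]
  rfl

theorem toBoard_injective : Function.Injective toBoard := fun _ _ h =>
  equivBoard.injective (Subtype.ext h)

theorem yPlus_adjointShift (k : ℤ) (W : SuperPipeDream) :
    (W.adjointShift k).yPlus = W.yPlus.adjointShift (k + 1) := by
  apply toBoard_injective
  rw [toBoard_adjointShift]
  have h := Board.flow_adjointShift k W.toBoard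
  rwa [← toBoard_adjointShift] at h

theorem yMinus_adjointShift (k : ℤ) (W : SuperPipeDream) :
    (W.adjointShift k).yMinus = W.yMinus.adjointShift (k - 1) := by
  refine (Equiv.symm_apply_eq yFlow).2 ?_
  have h := yPlus_adjointShift (k - 1) W.yMinus
  rw [sub_add_cancel] at h
  refine Eq.trans ?_ h.symm
  exact congrArg _ (yFlow.apply_symm_apply W).symm

theorem iterate_yPlus_adjoint (m : ℕ) (W : SuperPipeDream) :
    yPlus^[m] W.adjoint = (yPlus^[m] W).adjointShift m := by
  induction m with
  | zero => exact W.adjointShift_zero.symm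
  | succ m ih =>
    rw [Function.iterate_succ_apply', Function.iterate_succ_apply', ih, yPlus_adjointShift]
    push_cast
    rfl

theorem iterate_yMinus_adjoint (m : ℕ) (W : SuperPipeDream) :
    yMinus^[m] W.adjoint = (yMinus^[m] W).adjointShift (-m) := by
  induction m with
  | zero => exact W.adjointShift_zero.symm
  | succ m ih =>
    rw [Function.iterate_succ_apply', Function.iterate_succ_apply', ih, yMinus_adjointShift]
    congr 1
    push_cast
    ring

theorem mem_adjointShift {k i j : ℤ} {W : SuperPipeDream} :
    ((i, j) ∈ (W.adjointShift k).x.cells ↔ (j - k, i + k) ∈ W.y.cells) ∧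
      ((i, j) ∈ (W.adjointShift k).y.cells ↔ (j - k, i + k) ∈ W.x.cells) := by
  have h := toBoard_adjointShift k W
  rw [← Board.mem_image_transpose_shift, ← Board.mem_image_transpose_shift]
  exact ⟨iff_of_eq (congrArg (fun P : Board => (i, j) ∈ P.black) h),
    iff_of_eq (congrArg (fun P : Board => (i, j) ∈ P.red) h)⟩

theorem redNE_adjointShift {k : ℤ} {W : SuperPipeDream} :
    (W.adjointShift k).RedNE ↔ W.RedNE := by
  constructor
  · rintro h ⟨a, b⟩ hp ⟨c, d⟩ hq
    have := h (d - k, c + k) (mem_adjointShift.2.2 (by simpa using hq))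
      (b - k, a + k) (mem_adjointShift.1.2 (by simpa using hp))
    simp only at this ⊢
    omega
  · rintro h ⟨a, b⟩ hp ⟨c, d⟩ hq
    have := h _ (mem_adjointShift.1.1 hq) _ (mem_adjointShift.2.1 hp)
    simp only at this ⊢
    omega

theorem redSW_adjointShift {k : ℤ} {W : SuperPipeDream} :
    (W.adjointShift k).RedSW ↔ W.RedSW := by
  constructor
  · rintro h ⟨a, b⟩ hp ⟨c, d⟩ hq
    have := h (d - k, c + k) (mem_adjointShift.2.2 (by simpa using hq))
      (b - k, a + k) (mem_adjointShift.1.2 (by simpa using hp))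
    simp only at this ⊢
    omega
  · rintro h ⟨a, b⟩ hp ⟨c, d⟩ hq
    have := h _ (mem_adjointShift.1.1 hq) _ (mem_adjointShift.2.1 hp)
    simp only at this ⊢
    omega

/-! ### Rectification and adjoints -/

open Classical in
theorem rect_adjoint (W : SuperPipeDream) : W.adjoint.rect = W.rect.swap := by
  have hm : Nat.find W.adjoint.exists_redNE = Nat.find W.exists_redNE :=
    Nat.find_congr' fun {n} => by rw [iterate_yPlus_adjoint, redNE_adjointShift]
  simp only [rect]
  rw [hm, iterate_yPlus_adjoint]
  exact Prod.ext rfl (PipeDream.transpose_shift_transpose_shift _ _)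

open Classical in
theorem coRect_adjoint (W : SuperPipeDream) : W.adjoint.coRect = W.coRect.swap := by
  have hm : Nat.find W.adjoint.exists_redSW = Nat.find W.exists_redSW :=
    Nat.find_congr' fun {n} => by rw [iterate_yMinus_adjoint, redSW_adjointShift]
  simp only [coRect]
  rw [hm, iterate_yMinus_adjoint]
  exact Prod.ext rfl (PipeDream.transpose_shift_transpose_shift _ _)

end SuperPipeDream

theorem proposition6p3 (W : SuperPipeDream) (V U : PipeDream) :
    (W.rect = (V, U) → W.adjoint.rect = (U, V)) ∧
      (W.coRect = (V, U) → W.adjoint.coRect = (U, V)) :=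
  ⟨fun h => by rw [W.rect_adjoint, h, Prod.swap_prod_mk],
    fun h => by rw [W.coRect_adjoint, h, Prod.swap_prod_mk]⟩
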